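/- Let $N\ge 2$ be an integer and let $p>1$. Write $\Delta_p u=\operatorname{div}(|\nabla u|^{p-2}\nabla u)$. For a continuous function $h:\mathbb{R}^N\to\mathbb{R}$, a solution of $\Delta_p u = h$ on $\mathbb{R}^N$ is a function $u\in C^1(\mathbb{R}^N)$ such that $$-\int_{\mathbb{R}^N}|\nabla u|^{p-2}\,\nabla u\cdot\nabla\varphi\,dx=\int_{\mathbb{R}^N}h\,\varphi\,dx$$ for every nonnegative compactly supported $\varphi\in C^1(\mathbb{R}^N)$; a solution of $-\Delta_p u=h$ is a solution of $\Delta_p u=-h$. In the equations below, $h(x)$ is the right-hand side evaluated at $u(x)$. (i) Let $f:\mathbb{R}\to\mathbb{R}$ be a continuous nonincreasing function such that $f(t)>0$ for $t<0$, $f(t)<0$ for $t>0$, and $$\int_{-\infty}^{-1}\Big(\int_t^{-1}f(s)\,ds\Big)^{-1/p}dt<+\infty,\qquad \int_{1}^{\infty}\Big(\int_1^{t}-f(s)\,ds\Big)^{-1/p}dt<+\infty .$$ If $u$ is a solution of $-\Delta_p u=f(u)$ on $\mathbb{R}^N$, then $u\equiv 0$ on $\mathbb{R}^N$. (ii) In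 particular, if $q>p-1$ and $u$ is a solution of $\Delta_p u=|u|^{q-1}u$ on $\mathbb{R}^N$, then $u\equiv 0$ on $\mathbb{R}^N$. -/

import Mathlib

open MeasureTheory Set
open scoped Gradient

/-- `u` is a weak `C¹` solution of `div (A(|∇u|) ∇u) ≥ h` on `ℝ^N`: `u` is of class `C¹` and
`-∫ A(|∇u|) ∇u · ∇φ ≥ ∫ h φ` for every nonnegative compactly supported `φ` of class `C¹`. -/
def IsSolutionDivGE {N : ℕ} (A : ℝ → ℝ) (h u : EuclideanSpace ℝ (Fin N) → ℝ) : Prop :=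
  ContDiff ℝ 1 u ∧
    ∀ φ : EuclideanSpace ℝ (Fin N) → ℝ, ContDiff ℝ 1 φ → HasCompactSupport φ → (∀ x, 0 ≤ φ x) →
      -∫ x, inner ℝ (A ‖∇ u x‖ • ∇ u x) (∇ φ x) ≥ ∫ x, h x * φ x

/-- `u` is a weak `C¹` solution of `div (A(|∇u|) ∇u) ≤ h` on `ℝ^N`. -/
def IsSolutionDivLE {N : ℕ} (A : ℝ → ℝ) (h u : EuclideanSpace ℝ (Fin N) → ℝ) : Prop :=
  ContDiff ℝ 1 u ∧
    ∀ φ : EuclideanSpace ℝ (Fin N) → ℝ, ContDiff ℝ 1 φ → HasCompactSupport φ → (∀ x, 0 ≤ φ x) →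
      -∫ x, inner ℝ (A ‖∇ u x‖ • ∇ u x) (∇ φ x) ≤ ∫ x, h x * φ x

/-- `u` is a weak `C¹` solution of `Δ_p u = h` on `ℝ^N`, with `Δ_p u = div (|∇u|^(p-2) ∇u)`:
both inequalities hold. (For `p < 2` the field `|ξ|^(p-2) ξ` is `0` at `ξ = 0`, as it should be.) -/
def IsPLaplaceSolution {N : ℕ} (p : ℝ) (h u : EuclideanSpace ℝ (Fin N) → ℝ) : Prop :=
  IsSolutionDivGE (fun t => t ^ (p - 2)) h u ∧ IsSolutionDivLE (fun t => t ^ (p - 2)) h u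

/-- `u` is a weak `C¹` solution of `-Δ_p u = h` on `ℝ^N`. -/
def IsNegPLaplaceSolution {N : ℕ} (p : ℝ) (h u : EuclideanSpace ℝ (Fin N) → ℝ) : Prop :=
  IsPLaplaceSolution p (fun x => -h x) u

/-- Keller-Osserman condition at `-∞`: `∫_{-∞}^{-1} (∫_t^{-1} f(s) ds)^(-1/p) dt < ∞`. -/
def KellerOssermanNeg (p : ℝ) (f : ℝ → ℝ) : Prop :=
  IntegrableOn (fun t : ℝ => (∫ s in t..(-1), f s) ^ (-(1 / p))) (Iio (-1))

/-- Keller-Osserman condition at `+∞`: `∫_1^∞ (∫_1^t -f(s) ds)^(-1/p) dt < ∞`. -/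
def KellerOssermanPos (p : ℝ) (f : ℝ → ℝ) : Prop :=
  IntegrableOn (fun t : ℝ => (∫ s in (1 : ℝ)..t, -f s) ^ (-(1 / p))) (Ioi 1)

open Filter Topology

/-! With `g = -f`, it suffices that a subsolution of `Δ_p u = g(u)` is nonpositive: `-u` is then
handled by the reflected nonlinearity. The bound at a point `x₀` comes from comparison with radial
supersolutions of arbitrarily small height at `x₀`.

For `0 < a < 1`, let `w` solve `(|w'|^(p-2) w')' = ε g(w)` with `w 0 = a` and `w' 0 = 0`. The first
integral `w' = (c ∫_a^w g)^(1/p)`, `c = ε p / (p - 1)`, expresses the radius at which `w` reaches a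
level `M` as a travel-time integral. The Keller-Osserman condition bounds this radius by some `R`
that depends on neither `M` nor `u`. Taking `M` above `max u` on the ball of radius `R + 1` puts
`w(|x - x₀|)` above `u` on the shell between `R` and `R + 1`. Capping `g` at level `M` keeps `w`
global without changing the travel time to `M`.

Since `g` is nondecreasing, `w(|x - x₀|)` satisfies `Δ_p v ≤ N ε g(v)`, strictly below `g(v)` for `ε
= 1/(2N)`. Comparison then gives `u x₀ ≤ a`, and `a` tends to `0`. The main steps are
`exists_isRadialProfile`, `IsRadialProfile.isSolutionDivLE`, `le_of_isSolutionDiv` and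
`nonpos_of_isSolutionDivGE`. -/

/-! ### The travel-time integral -/

theorem mul_sub_le_integral_of_monotone {g : ℝ → ℝ} (hg : Continuous g) (hmono : Monotone g)
    {a s : ℝ} (hs : a ≤ s) : g a * (s - a) ≤ ∫ t in a..s, g t := by
  have := intervalIntegral.integral_mono_on (μ := volume) (f := fun _ => g a) hs
    intervalIntegrable_const
    (hg.intervalIntegrable a s) (fun t ht => hmono ht.1)
  simpa [mul_comm] using this

theorem integral_le_mul_sub_of_bound {g : ℝ → ℝ} (hg : Continuous g) {B : ℝ} {a s : ℝ}
    (hB : ∀ t ∈ Icc a s, g t ≤ B) (hs : a ≤ s) : ∫ t in a..s, g t ≤ B * (s - a) := by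
  have := intervalIntegral.integral_mono_on (μ := volume) (g := fun _ => B) hs
    (hg.intervalIntegrable a s) intervalIntegrable_const hB
  simpa [mul_comm] using this

/-- The integrand of the travel-time integral of `(|w'|^(p-2) w')' = ε g(w)`, where
`c = ε p / (p - 1)`. -/
noncomputable def travelKernel (p c a : ℝ) (g : ℝ → ℝ) (s : ℝ) : ℝ :=
  (c * ∫ t in a..s, g t) ^ (-(1 / p))

theorem travelKernel_le {p c a s : ℝ} {g : ℝ → ℝ} (hp : 1 < p) (hc : 0 < c)
    (hg : Continuous g) (hmono : Monotone g) (ha : 0 < g a) (hs : a < s) :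
    travelKernel p c a g s ≤ (c * g a) ^ (-(1 / p)) * (s - a) ^ (-(1 / p)) := by
  have h1 : 0 < s - a := sub_pos.2 hs
  rw [travelKernel, ← Real.mul_rpow (by positivity) h1.le]
  apply Real.rpow_le_rpow_of_nonpos (by positivity)
  · rw [mul_assoc]
    exact mul_le_mul_of_nonneg_left (mul_sub_le_integral_of_monotone hg hmono hs.le) hc.le
  · have : 0 < 1 / p := by positivity
    linarith

theorem integral_pos_of_monotone {g : ℝ → ℝ} (hg : Continuous g) (hmono : Monotone g) {a s : ℝ}
    (ha : 0 < g a) (hs : a < s) : 0 < ∫ t in a..s, g t :=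
  (mul_pos ha (sub_pos.2 hs)).trans_le (mul_sub_le_integral_of_monotone hg hmono hs.le)

theorem travelKernel_pos {p c a s : ℝ} {g : ℝ → ℝ} (hc : 0 < c)
    (hg : Continuous g) (hmono : Monotone g) (ha : 0 < g a) (hs : a < s) :
    0 < travelKernel p c a g s :=
  Real.rpow_pos_of_pos (mul_pos hc (integral_pos_of_monotone hg hmono ha hs)) _

theorem continuous_primitive_of_continuous {g : ℝ → ℝ} (hg : Continuous g) (a : ℝ) :
    Continuous fun s => ∫ t in a..s, g t :=
  intervalIntegral.continuous_primitive (fun _ _ => hg.intervalIntegrable _ _) a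

theorem travelKernel_continuousAt {p c a s : ℝ} {g : ℝ → ℝ} (hc : 0 < c)
    (hg : Continuous g) (hmono : Monotone g) (ha : 0 < g a) (hs : a < s) :
    ContinuousAt (travelKernel p c a g) s := by
  apply ContinuousAt.rpow_const
  · exact (continuous_const.mul (continuous_primitive_of_continuous hg a)).continuousAt
  · exact Or.inl (mul_pos hc (integral_pos_of_monotone hg hmono ha hs)).ne'

theorem measurable_travelKernel (p c a : ℝ) {g : ℝ → ℝ} (hg : Continuous g) :
    Measurable (travelKernel p c a g) :=
  (continuous_const.mul (continuous_primitive_of_continuous hg a)).measurable.pow_const _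

/-- The travel-time kernel, continued by `1` to the left of `a`. -/
noncomputable def extendedKernel (p c a : ℝ) (g : ℝ → ℝ) (s : ℝ) : ℝ :=
  if a < s then travelKernel p c a g s else 1

theorem extendedKernel_pos {p c a : ℝ} {g : ℝ → ℝ} (hc : 0 < c)
    (hg : Continuous g) (hmono : Monotone g) (ha : 0 < g a) (s : ℝ) :
    0 < extendedKernel p c a g s := by
  unfold extendedKernel
  split_ifs with h
  · exact travelKernel_pos hc hg hmono ha h
  · exact one_pos

theorem intervalIntegrable_shifted_rpow {p : ℝ} (hp : 1 < p) (a x y : ℝ) :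
    IntervalIntegrable (fun s : ℝ => (s - a) ^ (-(1 / p))) volume x y := by
  have hp' : -1 < -(1 / p) := by
    have : 1 / p < 1 := by rw [div_lt_one (by linarith)]; exact hp
    linarith
  have := (intervalIntegral.intervalIntegrable_rpow' hp' (a := x - a) (b := y - a)).comp_sub_right a
  simpa using this

/-- The only singularity is at `a`, where the kernel is at most a multiple of `(s - a)^(-1/p)`,
integrable because `p > 1`. -/
theorem intervalIntegrable_extendedKernel {p c a : ℝ} {g : ℝ → ℝ} (hp : 1 < p) (hc : 0 < c)
    (hg : Continuous g) (hmono : Monotone g) (ha : 0 < g a) (x y : ℝ) :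
    IntervalIntegrable (extendedKernel p c a g) volume x y := by
  have h1 : IntervalIntegrable
      (fun s : ℝ => 1 + (c * g a) ^ (-(1 / p)) * ‖(s - a) ^ (-(1 / p))‖) volume x y :=
    (intervalIntegrable_const).add ((intervalIntegrable_shifted_rpow hp a x y).norm.const_mul _)
  refine h1.mono_fun ?_ (Eventually.of_forall fun s => ?_)
  · exact (Measurable.ite measurableSet_Ioi (measurable_travelKernel p c a hg)
      measurable_const).aestronglyMeasurable
  · have h0 : 0 ≤ (c * g a) ^ (-(1 / p)) := by positivity
    dsimp only
    rw [Real.norm_of_nonneg (extendedKernel_pos hc hg hmono ha s).le,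
      Real.norm_of_nonneg (by positivity)]
    unfold extendedKernel
    split_ifs with h
    · rw [Real.norm_of_nonneg (Real.rpow_nonneg (sub_pos.2 h).le _)]
      linarith [travelKernel_le hp hc hg hmono ha h]
    · have := mul_nonneg h0 (norm_nonneg ((s - a) ^ (-(1 / p))))
      linarith

/-- The travel time from level `a` to level `t`. -/
noncomputable def travelTime (p c a : ℝ) (g : ℝ → ℝ) (t : ℝ) : ℝ :=
  ∫ s in a..t, extendedKernel p c a g s

theorem travelTime_eq {p c a t : ℝ} {g : ℝ → ℝ} (ht : a ≤ t) :
    travelTime p c a g t = ∫ s in a..t, travelKernel p c a g s := by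
  unfold travelTime
  apply intervalIntegral.integral_congr_ae
  refine Eventually.of_forall fun s hs => ?_
  rw [uIoc_of_le ht] at hs
  simp [extendedKernel, hs.1]

theorem strictMono_travelTime {p c a : ℝ} {g : ℝ → ℝ} (hp : 1 < p) (hc : 0 < c)
    (hg : Continuous g) (hmono : Monotone g) (ha : 0 < g a) :
    StrictMono (travelTime p c a g) := by
  intro x y hxy
  have hI := intervalIntegrable_extendedKernel hp hc hg hmono ha
  have h := intervalIntegral.intervalIntegral_pos_of_pos_on (hI x y)
    (fun s _ => extendedKernel_pos hc hg hmono ha s) hxy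
  rw [← intervalIntegral.integral_interval_sub_left (hI a y) (hI a x)] at h
  exact sub_pos.1 h

theorem continuous_travelTime {p c a : ℝ} {g : ℝ → ℝ} (hp : 1 < p) (hc : 0 < c)
    (hg : Continuous g) (hmono : Monotone g) (ha : 0 < g a) :
    Continuous (travelTime p c a g) :=
  intervalIntegral.continuous_primitive (intervalIntegrable_extendedKernel hp hc hg hmono ha) a

/-- For bounded `g` the kernel on `(a, t)` is at least `(c B (t - a))^(-1/p)`, so the time grows at
least like `(t - a)^(1 - 1/p)`. The profile therefore does not blow up at a finite radius. -/
theorem tendsto_travelTime_atTop {p c a B : ℝ} {g : ℝ → ℝ} (hp : 1 < p) (hc : 0 < c)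
    (hg : Continuous g) (hmono : Monotone g) (ha : 0 < g a) (hB : ∀ t, g t ≤ B) :
    Tendsto (travelTime p c a g) atTop atTop := by
  have hB0 : 0 < B := ha.trans_le (hB a)
  have hp0 : 0 < 1 / p := by positivity
  have hp1 : 0 < 1 - 1 / p := by
    have : 1 / p < 1 := by rw [div_lt_one (by linarith)]; exact hp
    linarith
  have hlim : Tendsto (fun t : ℝ => (c * B) ^ (-(1 / p)) * (t - a) ^ (1 - 1 / p)) atTop atTop :=
    ((tendsto_rpow_atTop hp1).comp (tendsto_atTop_add_const_right _ (-a) tendsto_id)).const_mul_atTop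
      (by positivity)
  refine tendsto_atTop_mono' _ ?_ hlim
  filter_upwards [eventually_gt_atTop a] with t ht
  have hta : 0 < t - a := sub_pos.2 ht
  have h2 : ∀ s ∈ Ioo a t, (c * B * (t - a)) ^ (-(1 / p)) ≤ extendedKernel p c a g s := by
    intro s hs
    rw [extendedKernel, if_pos hs.1, travelKernel]
    apply Real.rpow_le_rpow_of_nonpos
      (mul_pos hc (integral_pos_of_monotone hg hmono ha hs.1))
    · rw [mul_assoc]
      refine mul_le_mul_of_nonneg_left ?_ hc.le
      refine (integral_le_mul_sub_of_bound hg (fun t _ => hB t) hs.1.le).trans ?_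
      exact mul_le_mul_of_nonneg_left (by linarith [hs.2]) hB0.le
    · linarith
  have h3 := intervalIntegral.integral_mono_on_of_le_Ioo ht.le
    (f := fun _ => (c * B * (t - a)) ^ (-(1 / p))) (by simp)
    (intervalIntegrable_extendedKernel hp hc hg hmono ha a t) h2
  refine le_trans (le_of_eq ?_) h3
  rw [intervalIntegral.integral_const, smul_eq_mul, Real.mul_rpow (by positivity) hta.le,
    sub_eq_add_neg 1, Real.rpow_add hta, Real.rpow_one]
  ring

theorem tendsto_travelTime_atBot (p c a : ℝ) (g : ℝ → ℝ) :
    Tendsto (travelTime p c a g) atBot atBot := by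
  have : Tendsto (fun t : ℝ => t - a) atBot atBot := tendsto_atBot_add_const_right _ _ tendsto_id
  refine this.congr' ?_
  filter_upwards [eventually_le_atBot a] with t ht
  unfold travelTime
  rw [intervalIntegral.integral_symm, intervalIntegral.integral_congr_ae (g := fun _ => (1 : ℝ))]
  · simp
  · refine Eventually.of_forall fun s hs => ?_
    rw [uIoc_of_le ht] at hs
    simp [extendedKernel, hs.2]

theorem hasDerivAt_travelTime {p c a t : ℝ} {g : ℝ → ℝ} (hp : 1 < p) (hc : 0 < c)
    (hg : Continuous g) (hmono : Monotone g) (ha : 0 < g a) (ht : a < t) :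
    HasDerivAt (travelTime p c a g) (travelKernel p c a g t) t := by
  have heq : extendedKernel p c a g =ᶠ[𝓝 t] travelKernel p c a g := by
    filter_upwards [lt_mem_nhds ht] with s hs
    simp [extendedKernel, hs]
  have hct : ContinuousAt (extendedKernel p c a g) t :=
    (travelKernel_continuousAt hc hg hmono ha ht).congr heq.symm
  have := intervalIntegral.integral_hasDerivAt_right
    (intervalIntegrable_extendedKernel hp hc hg hmono ha a t)
    (Measurable.ite measurableSet_Ioi (measurable_travelKernel p c a hg)
      measurable_const).stronglyMeasurable.stronglyMeasurableAtFilter hct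
  rwa [heq.eq_of_nhds] at this

/-! ### One-dimensional radial profiles -/

/-- `w` solves `(|w'|^(p-2) w')' = ω` on `(0, ∞)` with `w' = D > 0` there and `D 0 = 0`. -/
structure IsRadialProfile (p : ℝ) (w D ω : ℝ → ℝ) : Prop where
  continuous_w : Continuous w
  continuous_D : Continuous D
  continuous_ω : Continuous ω
  monotone_w : Monotone w
  monotone_ω : Monotone ω
  D_zero : D 0 = 0
  D_pos : ∀ r, 0 < r → 0 < D r
  hasDerivAt_w : ∀ r, 0 < r → HasDerivAt w (D r) r
  hasDerivAt_W : ∀ r, 0 < r → HasDerivAt (fun r => D r ^ (p - 1)) (ω r) r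

/-- The profile is the inverse of the travel time, so no existence theorem for the degenerate
equation is needed. -/
theorem exists_isRadialProfile {p ε a B : ℝ} {g : ℝ → ℝ} (hp : 1 < p) (hε : 0 < ε)
    (hg : Continuous g) (hmono : Monotone g) (ha : 0 < g a) (hB : ∀ t, g t ≤ B) :
    ∃ w D : ℝ → ℝ, IsRadialProfile p w D (fun r => ε * g (w r)) ∧ w 0 = a ∧
      ∀ M, a ≤ M → w (∫ s in a..M, travelKernel p (p / (p - 1) * ε) a g s) = M := by
  have hp0 : 0 < p := by linarith
  have hp1 : 0 < p - 1 := by linarith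
  set c := p / (p - 1) * ε with hcdef
  have hc : 0 < c := by positivity
  have hsm := strictMono_travelTime hp hc hg hmono ha
  -- The continuation of the kernel by `1` makes the travel time a bijection of the whole line, so
  -- its inverse is globally defined and continuous.
  have hsurj : Function.Surjective (travelTime p c a g) :=
    (continuous_travelTime hp hc hg hmono ha).surjective
      (tendsto_travelTime_atTop hp hc hg hmono ha hB) (tendsto_travelTime_atBot p c a g)
  let e := StrictMono.orderIsoOfSurjective _ hsm hsurj
  set w : ℝ → ℝ := fun r => e.symm r with hw
  have hwc : Continuous w := e.symm.continuous
  have hFw : ∀ r, travelTime p c a g (w r) = r := fun r => e.apply_symm_apply r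
  have hwF : ∀ t, w (travelTime p c a g t) = t := fun t => e.symm_apply_apply t
  have hFa : travelTime p c a g a = 0 := by simp [travelTime]
  have hw0 : w 0 = a := by rw [← hFa, hwF]
  have hwa : ∀ r, 0 < r → a < w r := fun r hr => by
    rw [← hw0]; exact e.symm.strictMono hr
  have hGc := continuous_primitive_of_continuous hg a
  have hGpos : ∀ r, 0 < r → 0 < c * ∫ t in a..(w r), g t := fun r hr =>
    mul_pos hc (integral_pos_of_monotone hg hmono ha (hwa r hr))
  have hwd : ∀ r, 0 < r → HasDerivAt w ((c * ∫ t in a..(w r), g t) ^ (1 / p)) r := by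
    intro r hr
    have h1 := hasDerivAt_travelTime hp hc hg hmono ha (hwa r hr)
    have h2 := h1.of_local_left_inverse hwc.continuousAt
      (travelKernel_pos hc hg hmono ha (hwa r hr)).ne' (Eventually.of_forall hFw)
    rwa [travelKernel, ← Real.rpow_neg (hGpos r hr).le, neg_neg] at h2
  refine ⟨w, fun r => (c * ∫ t in a..(w r), g t) ^ (1 / p), ⟨hwc, ?_, ?_, ?_, ?_, ?_, ?_, hwd, ?_⟩,
    hw0, ?_⟩
  · exact (continuous_const.mul (hGc.comp hwc)).rpow_const fun _ => Or.inr (by positivity)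
  · exact continuous_const.mul (hg.comp hwc)
  · exact e.symm.monotone
  · intro x y hxy
    exact mul_le_mul_of_nonneg_left (hmono (e.symm.monotone hxy)) hε.le
  · simp [hw0, Real.zero_rpow (inv_ne_zero hp0.ne')]
  · exact fun r hr => Real.rpow_pos_of_pos (hGpos r hr) _
  · intro r hr
    have hG : HasDerivAt (fun s => c * ∫ t in a..s, g t) (c * g (w r)) (w r) :=
      (hg.integral_hasStrictDerivAt a (w r)).hasDerivAt.const_mul c
    -- Here `D^(p-1)` equals `(c ∫ g)^(1 - 1/p)`. In its derivative the powers of the integral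
    -- cancel and `c (1 - 1/p) = ε` remains.
    have h1 := (hG.comp r (hwd r hr)).rpow_const (p := (1 - 1 / p)) (Or.inl (hGpos r hr).ne')
    have h2 : HasDerivAt (fun r => (c * ∫ t in a..(w r), g t) ^ (1 - 1 / p)) (ε * g (w r)) r := by
      convert h1 using 1
      simp only [Function.comp_apply]
      set y := c * ∫ t in a..(w r), g t with hy
      have hy0 : 0 < y := hGpos r hr
      have : y ^ (1 / p) * y ^ (1 - 1 / p - 1) = 1 := by
        rw [← Real.rpow_add hy0]; simp
      calc ε * g (w r) = (c * (1 - 1 / p)) * g (w r) * 1 := by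
            rw [hcdef]; field_simp
        _ = c * g (w r) * y ^ (1 / p) * (1 - 1 / p) * y ^ (1 - 1 / p - 1) := by
            linear_combination (-(c * g (w r) * (1 - 1 / p))) * this
    refine h2.congr_of_eventuallyEq ?_
    filter_upwards [lt_mem_nhds hr] with s hs
    rw [← Real.rpow_mul (hGpos s hs).le]
    congr 1
    field_simp
  · intro M hM
    rw [← travelTime_eq hM, hwF]

/-! ### Radial functions: gradient and flux -/

section Radial

variable {E : Type*} [NormedAddCommGroup E] [InnerProductSpace ℝ E]

theorem hasFDerivAt_norm_of_ne_zero {x : E} (hx : x ≠ 0) :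
    HasFDerivAt (fun y : E => ‖y‖) (‖x‖⁻¹ • innerSL ℝ x) x := by
  have hn : 0 < ‖x‖ := norm_pos_iff.2 hx
  have h := ((hasStrictFDerivAt_norm_sq x).hasFDerivAt).sqrt (by positivity)
  simp only [Real.sqrt_sq (norm_nonneg _)] at h
  convert h using 1
  ext y
  simp
  field_simp

namespace IsRadialProfile

variable {p : ℝ} {w D ω : ℝ → ℝ}

theorem exists_slope_w (h : IsRadialProfile p w D ω) {r : ℝ} (hr : 0 < r) :
    ∃ s ∈ Ioo 0 r, w r - w 0 = D s * r := by
  obtain ⟨s, hs, he⟩ := exists_hasDerivAt_eq_slope w D hr h.continuous_w.continuousOn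
    (fun s hs => h.hasDerivAt_w s hs.1)
  refine ⟨s, hs, ?_⟩
  rw [he, sub_zero, div_mul_cancel₀ _ hr.ne']

theorem exists_slope_W (h : IsRadialProfile p w D ω) (hp : 1 < p) {r : ℝ} (hr : 0 < r) :
    ∃ s ∈ Ioo 0 r, D r ^ (p - 1) / r = ω s := by
  have hc : Continuous fun r => D r ^ (p - 1) :=
    h.continuous_D.rpow_const fun _ => Or.inr (by linarith)
  obtain ⟨s, hs, he⟩ := exists_hasDerivAt_eq_slope (fun r => D r ^ (p - 1)) ω hr hc.continuousOn
    (fun s hs => h.hasDerivAt_W s hs.1)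
  refine ⟨s, hs, ?_⟩
  rw [he]
  simp [h.D_zero, Real.zero_rpow (by linarith : p - 1 ≠ 0)]

theorem hasFDerivAt_radial (h : IsRadialProfile p w D ω) (x : E) :
    HasFDerivAt (fun y : E => w ‖y‖) ((D ‖x‖ / ‖x‖) • innerSL ℝ x) x := by
  rcases eq_or_ne x 0 with rfl | hx
  -- At the origin `D ‖0‖ / ‖0‖` is `0 / 0 = 0`; the mean value theorem and `D → 0` give the
  -- vanishing derivative.
  · rw [hasFDerivAt_iff_isLittleO_nhds_zero, Asymptotics.isLittleO_iff]
    intro c hc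
    have hD : ∀ᶠ r in 𝓝 (0 : ℝ), |D r| < c := by
      have := h.continuous_D.abs.tendsto 0
      rw [h.D_zero, abs_zero] at this
      exact this.eventually (gt_mem_nhds hc)
    obtain ⟨δ, hδ, hball⟩ := Metric.eventually_nhds_iff.1 hD
    filter_upwards [Metric.ball_mem_nhds (0 : E) hδ] with y hy
    rcases eq_or_ne y 0 with rfl | hy0
    · simp
    · have hn : 0 < ‖y‖ := norm_pos_iff.2 hy0
      obtain ⟨s, hs, he⟩ := h.exists_slope_w hn
      have h1 : |D s| < c := hball (by
        rw [Real.dist_eq, sub_zero, abs_of_pos hs.1]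
        exact hs.2.trans (by simpa using hy))
      simp only [zero_add, norm_zero, div_zero, zero_smul, zero_apply, sub_zero]
      rw [he, norm_mul, norm_norm, Real.norm_eq_abs]
      exact mul_le_mul_of_nonneg_right h1.le hn.le
  · have := (h.hasDerivAt_w ‖x‖ (norm_pos_iff.2 hx)).comp_hasFDerivAt x
      (hasFDerivAt_norm_of_ne_zero hx)
    rwa [smul_smul] at this

theorem norm_radial_gradient (h : IsRadialProfile p w D ω) (x : E) :
    ‖(D ‖x‖ / ‖x‖) • x‖ = D ‖x‖ := by
  rcases eq_or_ne x 0 with rfl | hx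
  · simp [h.D_zero]
  · have hn : 0 < ‖x‖ := norm_pos_iff.2 hx
    rw [norm_smul, norm_div, norm_norm, Real.norm_of_nonneg (h.D_pos _ hn).le]
    field_simp

theorem continuous_radial_gradient (h : IsRadialProfile p w D ω) :
    Continuous fun x : E => (D ‖x‖ / ‖x‖) • x := by
  rw [continuous_iff_continuousAt]
  intro x
  rcases eq_or_ne x 0 with rfl | hx
  · rw [ContinuousAt]
    simp only [smul_zero]
    rw [tendsto_zero_iff_norm_tendsto_zero]
    simp only [h.norm_radial_gradient]
    have := (h.continuous_D.comp (continuous_norm (E := E))).tendsto 0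
    simpa [h.D_zero, Function.comp_def] using this
  · refine ContinuousAt.smul (ContinuousAt.div ?_ continuous_norm.continuousAt
      (norm_ne_zero_iff.2 hx)) continuousAt_id
    exact (h.continuous_D.comp continuous_norm).continuousAt

theorem contDiff_radial (h : IsRadialProfile p w D ω) (x₀ : E) :
    ContDiff ℝ 1 fun x : E => w ‖x - x₀‖ := by
  have h0 : ContDiff ℝ 1 fun x : E => w ‖x‖ := by
    rw [contDiff_one_iff_hasFDerivAt]
    refine ⟨_, ?_, h.hasFDerivAt_radial⟩
    have := (innerSL ℝ (E := E)).continuous.comp h.continuous_radial_gradient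
    simpa [Function.comp_def] using this
  exact h0.comp (contDiff_id.sub contDiff_const)

theorem gradient_radial [CompleteSpace E] (h : IsRadialProfile p w D ω) (x₀ x : E) :
    ∇ (fun x : E => w ‖x - x₀‖) x = (D ‖x - x₀‖ / ‖x - x₀‖) • (x - x₀) := by
  apply HasGradientAt.gradient
  rw [hasGradientAt_iff_hasFDerivAt]
  refine ((hasFDerivAt_comp_sub x₀).2 (h.hasFDerivAt_radial (x - x₀))).congr_fderiv ?_
  ext y
  simp

theorem flux_radial [CompleteSpace E] (h : IsRadialProfile p w D ω) (x₀ x : E) :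
    ‖∇ (fun x : E => w ‖x - x₀‖) x‖ ^ (p - 2) • ∇ (fun x : E => w ‖x - x₀‖) x
      = (D ‖x - x₀‖ ^ (p - 1) / ‖x - x₀‖) • (x - x₀) := by
  rw [h.gradient_radial, h.norm_radial_gradient, smul_smul]
  rcases eq_or_ne (x - x₀) 0 with hx | hx
  · simp [hx]
  · have hD := h.D_pos _ (norm_pos_iff.2 hx)
    rw [← mul_div_assoc]
    congr 2
    nth_rewrite 2 [← Real.rpow_one (D ‖x - x₀‖)]
    rw [← Real.rpow_add hD]
    ring_nf

/-- With `W = D^(p-1)` and `r = ‖x‖`, the derivative along `e` is a convex combination of `W / r`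
and `W' = ω r`. By the mean value theorem `W / r` is a value of `ω` at a smaller radius, so
monotonicity of `ω` bounds both terms by `ω r`. At the origin `W / r → ω 0`. -/
theorem exists_hasFDerivAt_flux (h : IsRadialProfile p w D ω) (hp : 1 < p) (hω : 0 ≤ ω 0) {e : E}
    (he : ‖e‖ = 1) (x : E) :
    ∃ L : E →L[ℝ] ℝ,
      HasFDerivAt (fun y : E => D ‖y‖ ^ (p - 1) / ‖y‖ * inner ℝ e y) L x ∧
        0 ≤ L e ∧ L e ≤ ω ‖x‖ := by
  rcases eq_or_ne x 0 with rfl | hx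
  · refine ⟨ω 0 • innerSL ℝ e, ?_, ?_, ?_⟩
    · rw [hasFDerivAt_iff_isLittleO_nhds_zero, Asymptotics.isLittleO_iff]
      intro c hc
      have hev : ∀ᶠ r in 𝓝 (0 : ℝ), |ω r - ω 0| < c := by
        have : Tendsto (fun r => |ω r - ω 0|) (𝓝 0) (𝓝 |ω 0 - ω 0|) :=
          (h.continuous_ω.sub continuous_const).abs.tendsto 0
        rw [sub_self, abs_zero] at this
        exact this.eventually (gt_mem_nhds hc)
      obtain ⟨δ, hδ, hball⟩ := Metric.eventually_nhds_iff.1 hev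
      filter_upwards [Metric.ball_mem_nhds (0 : E) hδ] with y hy
      rcases eq_or_ne y 0 with rfl | hy0
      · simp
      · have hn : 0 < ‖y‖ := norm_pos_iff.2 hy0
        obtain ⟨s, hs, hse⟩ := h.exists_slope_W hp hn
        have h1 : |ω s - ω 0| < c := hball (by
          rw [Real.dist_eq, sub_zero, abs_of_pos hs.1]
          exact hs.2.trans (by simpa using hy))
        have h2 : |inner ℝ e y| ≤ ‖y‖ := by
          simpa [he] using abs_real_inner_le_norm e y
        simp only [zero_add, inner_zero_right, mul_zero, sub_zero, hse,
          smul_apply, innerSL_apply_apply, smul_eq_mul]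
        rw [← sub_mul, norm_mul, Real.norm_eq_abs, Real.norm_eq_abs]
        exact mul_le_mul h1.le h2 (abs_nonneg _) hc.le
    · simp [he, hω]
    · simp [he]
  · have hn : 0 < ‖x‖ := norm_pos_iff.2 hx
    have h1 := ((h.hasDerivAt_W _ hn).div (hasDerivAt_id _) hn.ne').comp_hasFDerivAt x
      (hasFDerivAt_norm_of_ne_zero hx)
    have h2 := h1.mul ((innerSL ℝ e).hasFDerivAt (x := x))
    refine ⟨_, h2, ?_⟩
    obtain ⟨s, hs, hse⟩ := h.exists_slope_W hp hn
    have hb0 : 0 ≤ ω s := hω.trans (h.monotone_ω hs.1.le)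
    have hb1 : ω s ≤ ω ‖x‖ := h.monotone_ω hs.2.le
    have hW : D ‖x‖ ^ (p - 1) = ω s * ‖x‖ := by rw [← hse]; field_simp
    have hcs : |inner ℝ e x| ≤ ‖x‖ := by simpa [he] using abs_real_inner_le_norm e x
    -- The weight `q` is the squared cosine of the angle between `e` and `x`.
    set q := inner ℝ e x ^ 2 / ‖x‖ ^ 2 with hq
    have hq0 : 0 ≤ q := by positivity
    have hq1 : q ≤ 1 := by
      rw [hq, div_le_one (by positivity)]
      exact sq_le_sq.2 (by simpa using hcs)
    have key : ω s + (ω ‖x‖ - ω s) * q = (1 - q) * ω s + q * ω ‖x‖ := by ring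
    have hval : ∀ a : ℝ, a = (1 - q) * ω s + q * ω ‖x‖ → 0 ≤ a ∧ a ≤ ω ‖x‖ := by
      rintro a rfl
      constructor
      · have := mul_nonneg (sub_nonneg.2 hq1) hb0
        have := mul_nonneg hq0 (hb0.trans hb1)
        linarith
      · nlinarith
    apply hval
    rw [← key]
    simp [he, real_inner_comm, hW]
    rw [hq]
    field_simp

end IsRadialProfile

end Radial

/-! ### The vector field `|ξ|^(p-2) ξ` -/

section Flux

variable {E : Type*} [NormedAddCommGroup E] [InnerProductSpace ℝ E]

theorem norm_rpow_smul_self {p : ℝ} (hp : 1 < p) (ξ : E) :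
    ‖‖ξ‖ ^ (p - 2) • ξ‖ = ‖ξ‖ ^ (p - 1) := by
  rcases eq_or_ne ξ 0 with rfl | hξ
  · simp [Real.zero_rpow (by linarith : p - 1 ≠ 0)]
  · have hn : 0 < ‖ξ‖ := norm_pos_iff.2 hξ
    rw [norm_smul, Real.norm_of_nonneg (by positivity)]
    nth_rewrite 2 [← Real.rpow_one ‖ξ‖]
    rw [← Real.rpow_add hn]
    ring_nf

theorem continuous_norm_rpow_smul_self {p : ℝ} (hp : 1 < p) :
    Continuous fun ξ : E => ‖ξ‖ ^ (p - 2) • ξ := by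
  rw [continuous_iff_continuousAt]
  intro ξ
  rcases eq_or_ne ξ 0 with rfl | hξ
  · rw [ContinuousAt, smul_zero, tendsto_zero_iff_norm_tendsto_zero]
    simp only [norm_rpow_smul_self hp]
    have hc : Continuous fun ξ : E => ‖ξ‖ ^ (p - 1) :=
      continuous_norm.rpow_const fun _ => Or.inr (by linarith)
    simpa [Real.zero_rpow (by linarith : p - 1 ≠ 0)] using hc.tendsto 0
  · exact (continuous_norm.continuousAt.rpow_const (Or.inl (norm_ne_zero_iff.2 hξ))).smul
      continuousAt_id

/-- Cauchy-Schwarz on the cross terms reduces the claim to the monotonicity of `t ↦ t^(p-1)` on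
norms. -/
theorem inner_flux_sub_nonneg {p : ℝ} (hp : 1 < p) (ξ η : E) :
    0 ≤ inner ℝ (‖ξ‖ ^ (p - 2) • ξ - ‖η‖ ^ (p - 2) • η) (ξ - η) := by
  have hpow : ∀ x : E, ‖x‖ ^ (p - 2) * ‖x‖ = ‖x‖ ^ (p - 1) := fun x => by
    rw [← norm_rpow_smul_self hp x, norm_smul, Real.norm_of_nonneg (by positivity)]
  have hmono : 0 ≤ (‖ξ‖ ^ (p - 1) - ‖η‖ ^ (p - 1)) * (‖ξ‖ - ‖η‖) := by
    rcases le_total ‖ξ‖ ‖η‖ with h | h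
    · have := Real.rpow_le_rpow (norm_nonneg ξ) h (by linarith : 0 ≤ p - 1)
      exact mul_nonneg_of_nonpos_of_nonpos (by linarith) (by linarith)
    · have := Real.rpow_le_rpow (norm_nonneg η) h (by linarith : 0 ≤ p - 1)
      exact mul_nonneg (by linarith) (by linarith)
  refine hmono.trans ?_
  have hcs := real_inner_le_norm ξ η
  have hA : 0 ≤ ‖ξ‖ ^ (p - 2) := by positivity
  have hB : 0 ≤ ‖η‖ ^ (p - 2) := by positivity
  rw [← hpow ξ, ← hpow η]
  simp only [inner_sub_left, inner_sub_right, real_inner_smul_left, real_inner_self_eq_norm_sq,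
    real_inner_comm ξ η]
  nlinarith [mul_le_mul_of_nonneg_left hcs (add_nonneg hA hB)]

end Flux

/-! ### Gradients and the radial supersolution -/

theorem ContDiff.continuous_gradient {E : Type*} [NormedAddCommGroup E] [InnerProductSpace ℝ E]
    [CompleteSpace E] {u : E → ℝ} (hu : ContDiff ℝ 1 u) : Continuous (∇ u) := by
  have := (InnerProductSpace.toDual ℝ E).symm.continuous.comp (hu.continuous_fderiv one_ne_zero)
  exact this

theorem HasCompactSupport.gradient {E : Type*} [NormedAddCommGroup E] [InnerProductSpace ℝ E]
    [CompleteSpace E] {u : E → ℝ} (hu : HasCompactSupport u) : HasCompactSupport (∇ u) :=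
  (hu.fderiv (𝕜 := ℝ)).comp_left (g := (InnerProductSpace.toDual ℝ E).symm) (map_zero _)

variable {N : ℕ}

/-- A radial function whose one-dimensional flux `W` satisfies `W' = ω` with `ω` nondecreasing
is a supersolution of `Δ_p v = N ω`. -/
theorem IsRadialProfile.isSolutionDivLE {p : ℝ} {w D ω : ℝ → ℝ} (h : IsRadialProfile p w D ω)
    (hp : 1 < p) (hω : 0 ≤ ω 0) (x₀ : EuclideanSpace ℝ (Fin N)) :
    IsSolutionDivLE (fun t => t ^ (p - 2)) (fun x => N * ω ‖x - x₀‖) (fun x => w ‖x - x₀‖) := by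
  refine ⟨h.contDiff_radial x₀, fun φ hφ hφc hφ0 => ?_⟩
  let e : Fin N → EuclideanSpace ℝ (Fin N) := fun i => EuclideanSpace.single i 1
  have he : ∀ i, ‖e i‖ = 1 := fun i => by simp [e]
  let V : Fin N → EuclideanSpace ℝ (Fin N) → ℝ := fun i x =>
    D ‖x - x₀‖ ^ (p - 1) / ‖x - x₀‖ * inner ℝ (e i) (x - x₀)
  have hV : ∀ i x, DifferentiableAt ℝ (V i) x ∧ 0 ≤ fderiv ℝ (V i) x (e i) ∧
      fderiv ℝ (V i) x (e i) ≤ ω ‖x - x₀‖ := by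
    intro i x
    obtain ⟨L, hL, h0, h1⟩ := h.exists_hasFDerivAt_flux hp hω (he i) (x - x₀)
    have hL' : HasFDerivAt (V i) L x := (hasFDerivAt_comp_sub x₀).2 hL
    exact ⟨hL'.differentiableAt, by rwa [hL'.fderiv], by rwa [hL'.fderiv]⟩
  have hVc : ∀ i, Continuous (V i) := fun i =>
    continuous_iff_continuousAt.2 fun x => (hV i x).1.continuousAt
  have hωc : Continuous fun x : EuclideanSpace ℝ (Fin N) => ω ‖x - x₀‖ :=
    h.continuous_ω.comp (continuous_id.sub continuous_const).norm
  have hωi : Integrable fun x => ω ‖x - x₀‖ * φ x :=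
    (hωc.mul hφ.continuous).integrable_of_hasCompactSupport hφc.mul_left
  -- The two-sided bound `0 ≤ ∂ᵢVᵢ ≤ ω` gives integrability without continuity of the derivative.
  have hi1 : ∀ i, Integrable fun x => fderiv ℝ (V i) x (e i) * φ x := by
    intro i
    refine hωi.mono' ?_ (Eventually.of_forall fun x => ?_)
    · exact ((measurable_fderiv_apply_const ℝ (V i) (e i)).mul
        hφ.continuous.measurable).aestronglyMeasurable
    · rw [Real.norm_of_nonneg (mul_nonneg (hV i x).2.1 (hφ0 x))]
      exact mul_le_mul_of_nonneg_right (hV i x).2.2 (hφ0 x)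
  have hi2 : ∀ i, Integrable fun x => V i x * fderiv ℝ φ x (e i) := fun i =>
    ((hVc i).mul ((hφ.continuous_fderiv one_ne_zero).clm_apply
      continuous_const)).integrable_of_hasCompactSupport
      ((hφc.fderiv_apply (𝕜 := ℝ) (e i)).mul_left)
  have hi3 : ∀ i, Integrable fun x => V i x * φ x := fun i =>
    ((hVc i).mul hφ.continuous).integrable_of_hasCompactSupport hφc.mul_left
  -- Integration by parts in each coordinate; each of the `N` directions contributes at most `ω`,
  -- whence the factor `N`.
  have hparts : ∀ i, -∫ x, V i x * fderiv ℝ φ x (e i) ≤ ∫ x, ω ‖x - x₀‖ * φ x := by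
    intro i
    rw [integral_mul_fderiv_eq_neg_fderiv_mul_of_integrable (hi1 i) (hi2 i) (hi3 i)
      (fun x _ => (hV i x).1) (fun x _ => hφ.differentiable one_ne_zero x), neg_neg]
    exact integral_mono (hi1 i) hωi fun x => mul_le_mul_of_nonneg_right (hV i x).2.2 (hφ0 x)
  have hinner : ∀ x, inner ℝ (‖∇ (fun x => w ‖x - x₀‖) x‖ ^ (p - 2) • ∇ (fun x => w ‖x - x₀‖) x)
      (∇ φ x) = ∑ i, V i x * fderiv ℝ φ x (e i) := by
    intro x
    rw [h.flux_radial, PiLp.inner_apply]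
    refine Finset.sum_congr rfl fun i _ => ?_
    have hi : fderiv ℝ φ x (e i) = (∇ φ x) i := by
      rw [← inner_gradient_left, EuclideanSpace.inner_single_right]
      simp
    rw [hi]
    simp [V, e, EuclideanSpace.inner_single_left]
    ring
  simp only [hinner]
  rw [integral_finsetSum _ fun i _ => hi2 i, ← Finset.sum_neg_distrib]
  refine (Finset.sum_le_sum fun i _ => hparts i).trans (le_of_eq ?_)
  simp only [Finset.sum_const, Finset.card_univ, Fintype.card_fin, nsmul_eq_mul, mul_assoc]
  rw [integral_const_mul]

/-! ### Comparison principle -/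

theorem gradient_comp_sub_mul {E : Type*} [NormedAddCommGroup E] [InnerProductSpace ℝ E]
    [CompleteSpace E] {u v χ : E → ℝ} {β : ℝ → ℝ} {b : ℝ} {x : E}
    (hβ : HasDerivAt β b (u x - v x)) (hu : DifferentiableAt ℝ u x)
    (hv : DifferentiableAt ℝ v x) (hχ : DifferentiableAt ℝ χ x) :
    ∇ (fun y => β (u y - v y) * χ y) x
      = (χ x * b) • (∇ u x - ∇ v x) + β (u x - v x) • ∇ χ x := by
  apply HasGradientAt.gradient
  rw [hasGradientAt_iff_hasFDerivAt]
  have h1 := (hβ.comp_hasFDerivAt x (hu.hasFDerivAt.sub hv.hasFDerivAt)).mul hχ.hasFDerivAt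
  refine h1.congr_fderiv ?_
  ext y
  simp only [map_add, map_smul, map_sub, toDual_gradient]
  simp
  ring

/-- Comparison principle: a subsolution lying below a supersolution on a spherical shell lies below
it at the centre, provided the right-hand sides are strictly ordered wherever it is larger. -/
theorem le_of_isSolutionDiv {p : ℝ} (hp : 1 < p) {h k u v : EuclideanSpace ℝ (Fin N) → ℝ}
    (hh : Continuous h) (hk : Continuous k)
    (hu : IsSolutionDivGE (fun t => t ^ (p - 2)) h u)
    (hv : IsSolutionDivLE (fun t => t ^ (p - 2)) k v)
    {x₀ : EuclideanSpace ℝ (Fin N)} {R : ℝ} (hR : 0 < R)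
    (hshell : ∀ x, R ≤ dist x x₀ → dist x x₀ ≤ R + 1 → u x ≤ v x)
    (hlt : ∀ x, v x < u x → k x < h x) : u x₀ ≤ v x₀ := by
  by_contra! hcon
  let χ : ContDiffBump x₀ := ⟨R, R + 1, hR, by linarith⟩
  have hβ : ∀ s, HasDerivAt expNegInvGlue (deriv expNegInvGlue s) s := fun s =>
    ((expNegInvGlue.contDiff (n := 1)).differentiable one_ne_zero s).hasDerivAt
  have hβ' : ∀ s, 0 ≤ deriv expNegInvGlue s := fun s => expNegInvGlue.monotone.deriv_nonneg
  have hud := hu.1.differentiable one_ne_zero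
  have hvd := hv.1.differentiable one_ne_zero
  have hχd : Differentiable ℝ χ := (χ.contDiff (n := 1)).differentiable one_ne_zero
  -- `expNegInvGlue` is a smooth nondecreasing substitute for the positive part: zero on `(-∞, 0]`,
  -- positive on `(0, ∞)`.
  let φ : EuclideanSpace ℝ (Fin N) → ℝ := fun x => expNegInvGlue (u x - v x) * χ x
  have hφ : ContDiff ℝ 1 φ := (expNegInvGlue.contDiff.comp (hu.1.sub hv.1)).mul χ.contDiff
  have hφc : HasCompactSupport φ := χ.hasCompactSupport.mul_left
  have hφ0 : ∀ x, 0 ≤ φ x := fun x => mul_nonneg (expNegInvGlue.nonneg _) χ.nonneg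
  -- The cutoff `χ` can vary only on the shell, where `u ≤ v` makes the other factor vanish. Hence
  -- the cutoff leaves no error term in `∇ φ`.
  have hzero : ∀ x, expNegInvGlue (u x - v x) • ∇ χ x = 0 := by
    intro x
    rcases lt_or_ge (dist x x₀) R with h1 | h1
    · have : χ =ᶠ[𝓝 x] fun _ => (1 : ℝ) := χ.eventuallyEq_one_of_mem_ball h1
      rw [this.gradient_eq]
      simp
    · rcases le_or_gt (dist x x₀) (R + 1) with h2 | h2
      · rw [expNegInvGlue.zero_of_nonpos (sub_nonpos.2 (hshell x h1 h2)), zero_smul]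
      · have : χ =ᶠ[𝓝 x] fun _ => (0 : ℝ) := by
          filter_upwards [(continuous_id.dist continuous_const).continuousAt.eventually
            (lt_mem_nhds h2)] with y hy
          exact χ.zero_of_le_dist (le_of_lt hy)
        rw [this.gradient_eq]
        simp
  have hgrad : ∀ x, ∇ φ x = (χ x * deriv expNegInvGlue (u x - v x)) • (∇ u x - ∇ v x) := by
    intro x
    have := gradient_comp_sub_mul (hβ (u x - v x)) (hud x) (hvd x) (hχd x)
    rw [hzero, add_zero] at this
    exact this
  have hint : ∀ z : EuclideanSpace ℝ (Fin N) → ℝ, ContDiff ℝ 1 z →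
      Integrable fun x => inner ℝ (‖∇ z x‖ ^ (p - 2) • ∇ z x) (∇ φ x) := by
    intro z hz
    refine (((continuous_norm_rpow_smul_self hp).comp hz.continuous_gradient).inner
      hφ.continuous_gradient).integrable_of_hasCompactSupport ?_
    refine hφc.gradient.mono fun x hx => ?_
    contrapose! hx
    simp only [Function.mem_support, not_not] at hx ⊢
    rw [hx, inner_zero_right]
  have hhi : Integrable fun x => h x * φ x :=
    (hh.mul hφ.continuous).integrable_of_hasCompactSupport hφc.mul_left
  have hki : Integrable fun x => k x * φ x :=
    (hk.mul hφ.continuous).integrable_of_hasCompactSupport hφc.mul_left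
  have h1 := hu.2 φ hφ hφc hφ0
  have h2 := hv.2 φ hφ hφc hφ0
  have h3 : ∫ x, inner ℝ (‖∇ v x‖ ^ (p - 2) • ∇ v x) (∇ φ x)
      ≤ ∫ x, inner ℝ (‖∇ u x‖ ^ (p - 2) • ∇ u x) (∇ φ x) := by
    refine integral_mono (hint v hv.1) (hint u hu.1) fun x => ?_
    rw [← sub_nonneg, ← inner_sub_left, hgrad, real_inner_smul_right]
    exact mul_nonneg (mul_nonneg χ.nonneg (hβ' _)) (inner_flux_sub_nonneg hp _ _)
  have hmul : ∀ x, 0 ≤ (h x - k x) * φ x := by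
    intro x
    rcases lt_or_ge (v x) (u x) with hx | hx
    · exact mul_nonneg (sub_nonneg.2 (hlt x hx).le) (hφ0 x)
    · simp [φ, expNegInvGlue.zero_of_nonpos (sub_nonpos.2 hx)]
  -- The two weak inequalities and monotonicity of the flux force this integral to be at most `0`;
  -- the strict ordering at `x₀` makes it positive.
  have hpos : 0 < ∫ x, (h x - k x) * φ x := by
    refine ((hh.sub hk).mul hφ.continuous).integral_pos_of_hasCompactSupport_nonneg_nonzero
      (x := x₀) hφc.mul_left hmul ?_
    have hχ : χ x₀ = 1 := χ.one_of_mem_closedBall (Metric.mem_closedBall_self hR.le)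
    exact mul_ne_zero (sub_ne_zero.2 (hlt x₀ hcon).ne')
      (mul_ne_zero (expNegInvGlue.pos_of_pos (sub_pos.2 hcon)).ne' (by rw [hχ]; exact one_ne_zero))
  simp only [sub_mul] at hpos
  rw [integral_sub hhi hki] at hpos
  linarith

/-! ### The Keller-Osserman bound -/

/-- On `(a, 1]` the singularity is integrable. Beyond `1`, starting the inner integral at `a`
instead of `1` enlarges it, and the negative power then lies below the Keller-Osserman integrand
times `c^(-1/p)`. -/
theorem integrableOn_travelKernel {p c a : ℝ} {g : ℝ → ℝ} (hp : 1 < p) (hc : 0 < c)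
    (hg : Continuous g) (hmono : Monotone g) (ha : 0 < g a) (ha1 : a < 1)
    (hKO : IntegrableOn (fun t : ℝ => (∫ s in (1 : ℝ)..t, g s) ^ (-(1 / p))) (Ioi 1)) :
    IntegrableOn (travelKernel p c a g) (Ioi a) := by
  rw [← Ioc_union_Ioi_eq_Ioi ha1.le]
  refine IntegrableOn.union ?_ ?_
  · have := (intervalIntegrable_iff_integrableOn_Ioc_of_le ha1.le).1
      (intervalIntegrable_extendedKernel hp hc hg hmono ha a 1)
    refine this.congr_fun (fun s hs => ?_) measurableSet_Ioc
    simp [extendedKernel, hs.1]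
  · refine Integrable.mono' (hKO.const_mul (c ^ (-(1 / p))))
      (measurable_travelKernel p c a hg).aestronglyMeasurable ?_
    filter_upwards [ae_restrict_mem measurableSet_Ioi] with t ht
    have ht : (1 : ℝ) < t := ht
    have h1 : 0 < ∫ s in (1 : ℝ)..t, g s :=
      integral_pos_of_monotone hg hmono (ha.trans_le (hmono ha1.le)) ht
    have h2 : ∫ s in (1 : ℝ)..t, g s ≤ ∫ s in a..t, g s := by
      rw [← intervalIntegral.integral_add_adjacent_intervals (hg.intervalIntegrable a 1)
        (hg.intervalIntegrable 1 t)]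
      linarith [integral_pos_of_monotone hg hmono ha ha1]
    rw [Real.norm_of_nonneg (travelKernel_pos hc hg hmono ha (ha1.trans ht)).le,
      ← Real.mul_rpow hc.le h1.le]
    refine Real.rpow_le_rpow_of_nonpos (by positivity) (mul_le_mul_of_nonneg_left h2 hc.le) ?_
    have : 0 < 1 / p := by positivity
    linarith

/-- Keller-Osserman: a subsolution of `Δ_p u = g(u)` on the whole space is nonpositive. -/
theorem nonpos_of_isSolutionDivGE (hN : 0 < N) {p : ℝ} (hp : 1 < p) {g : ℝ → ℝ}
    (hg : Continuous g) (hmono : Monotone g) (hpos : ∀ t, 0 < t → 0 < g t)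
    (hKO : IntegrableOn (fun t : ℝ => (∫ s in (1 : ℝ)..t, g s) ^ (-(1 / p))) (Ioi 1))
    {u : EuclideanSpace ℝ (Fin N) → ℝ}
    (hu : IsSolutionDivGE (fun t => t ^ (p - 2)) (fun x => g (u x)) u)
    (x₀ : EuclideanSpace ℝ (Fin N)) : u x₀ ≤ 0 := by
  suffices H : ∀ a, 0 < a → a < 1 → u x₀ ≤ a by
    by_contra! hcon
    have h1 := H (min (u x₀ / 2) (1 / 2)) (by positivity)
      ((min_le_right _ _).trans_lt (by norm_num))
    have h2 := min_le_left (u x₀ / 2) (1 / 2 : ℝ)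
    linarith
  intro a ha0 ha1
  have hN' : (0 : ℝ) < N := Nat.cast_pos.2 hN
  have hp1 : 0 < p - 1 := by linarith
  -- This makes `N ε = 1/2`, leaving the strict gap required by the comparison.
  set ε : ℝ := 1 / (2 * N) with hε
  have hε0 : 0 < ε := by positivity
  set c := p / (p - 1) * ε with hc
  have hc0 : 0 < c := by positivity
  have hga : 0 < g a := hpos a ha0
  have hK := integrableOn_travelKernel hp hc0 hg hmono hga ha1 hKO
  have hKpos : ∀ s ∈ Ioi a, 0 ≤ travelKernel p c a g s := fun s hs =>
    (travelKernel_pos hc0 hg hmono hga hs).le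
  -- `R` is fixed before `M`, so `M` may depend on `R`; the added `1` ensures `R > 0`.
  set R := (∫ s in Ioi a, travelKernel p c a g s) + 1 with hR
  have hR0 : 0 < R := by
    have := setIntegral_nonneg measurableSet_Ioi hKpos (μ := volume)
    linarith
  obtain ⟨M₀, hM₀⟩ := (isCompact_closedBall x₀ (R + 1)).bddAbove_image hu.1.continuous.continuousOn
  set M := max M₀ 1 with hM
  have hM1 : 1 ≤ M := le_max_right _ _
  have hua : ∀ x, dist x x₀ ≤ R + 1 → u x ≤ M := fun x hx =>
    (hM₀ (mem_image_of_mem u (Metric.mem_closedBall.2 hx))).trans (le_max_left _ _)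
  -- Capping at `M` makes the nonlinearity bounded, as the global profile requires.
  let γ : ℝ → ℝ := fun t => g (min t M)
  have hγc : Continuous γ := hg.comp (continuous_id.min continuous_const)
  have hγm : Monotone γ := fun x y hxy => hmono (min_le_min_right _ hxy)
  have hγg : ∀ t, t ≤ M → γ t = g t := fun t ht => by simp [γ, min_eq_left ht]
  have haM : a ≤ M := ha1.le.trans hM1
  obtain ⟨w, D, hw, hw0, hwM⟩ := exists_isRadialProfile hp hε0 hγc hγm
    (by rwa [hγg a haM]) (B := g M) (fun t => hmono (min_le_right _ _))
  have hwa : ∀ r, 0 ≤ r → a ≤ w r := fun r hr => hw0 ▸ hw.monotone_w hr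
  have hT : ∫ s in a..M, travelKernel p c a γ s ≤ R := by
    have h1 : ∫ s in a..M, travelKernel p c a γ s = ∫ s in a..M, travelKernel p c a g s := by
      refine intervalIntegral.integral_congr fun s hs => ?_
      rw [uIcc_of_le haM] at hs
      have : ∫ t in a..s, γ t = ∫ t in a..s, g t := by
        refine intervalIntegral.integral_congr fun t ht => ?_
        rw [uIcc_of_le hs.1] at ht
        exact hγg t (ht.2.trans hs.2)
      simp only [travelKernel, this]
    rw [h1, intervalIntegral.integral_of_le haM]
    have h2 := setIntegral_mono_set hK
      ((ae_restrict_iff' measurableSet_Ioi).2 (Eventually.of_forall hKpos))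
      (Ioc_subset_Ioi_self : Ioc a M ⊆ Ioi a).eventuallyLE
    linarith
  have hwR : ∀ r, R ≤ r → M ≤ w r := fun r hr =>
    (hwM M haM).symm.le.trans (hw.monotone_w (hT.trans hr))
  have hγpos : ∀ r, 0 ≤ r → 0 < γ (w r) := fun r hr => by
    have h1 : γ a ≤ γ (w r) := hγm (hwa r hr)
    rw [hγg a haM] at h1
    linarith
  have hv := hw.isSolutionDivLE hp (mul_pos hε0 (hγpos 0 le_rfl)).le x₀
  have hkc : Continuous fun x : EuclideanSpace ℝ (Fin N) => N * (ε * γ (w ‖x - x₀‖)) :=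
    continuous_const.mul (hw.continuous_ω.comp (continuous_id.sub continuous_const).norm)
  have hle := le_of_isSolutionDiv hp (hg.comp hu.1.continuous) hkc hu hv hR0
    (fun x h1 h2 => (hua x h2).trans (hwR _ (by rwa [← dist_eq_norm]))) (fun x hx => ?_)
  · simpa [hw0] using hle
  -- Where `v < u`, the chain is `N ε γ(v) = γ(v)/2 < γ(v) ≤ g(v) ≤ g(u)`; it also covers points
  -- where `v` exceeds `M`.
  · have h1 := hγpos _ (norm_nonneg (x - x₀))
    have h2 : γ (w ‖x - x₀‖) ≤ g (w ‖x - x₀‖) := hmono (min_le_left _ _)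
    have h3 : g (w ‖x - x₀‖) ≤ g (u x) := hmono hx.le
    have h4 : N * (ε * γ (w ‖x - x₀‖)) = γ (w ‖x - x₀‖) / 2 := by
      rw [hε]; field_simp
    rw [h4]
    show _ < g (u x)
    linarith

/-! ### Reflection and part (i) -/

theorem gradient_neg {E : Type*} [NormedAddCommGroup E] [InnerProductSpace ℝ E]
    [CompleteSpace E] (u : E → ℝ) (x : E) : ∇ (fun y => -u y) x = -∇ u x := by
  simp only [gradient]
  rw [fderiv_fun_neg, map_neg]

theorem IsSolutionDivLE.neg {A : ℝ → ℝ} {h u : EuclideanSpace ℝ (Fin N) → ℝ}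
    (hu : IsSolutionDivLE A h u) : IsSolutionDivGE A (fun x => -h x) (fun x => -u x) := by
  refine ⟨hu.1.neg, fun φ hφ hφc hφ0 => ?_⟩
  have := hu.2 φ hφ hφc hφ0
  simp only [gradient_neg, norm_neg, smul_neg, inner_neg_left, neg_mul, integral_neg]
  linarith

theorem kellerOssermanNeg_iff (p : ℝ) (f : ℝ → ℝ) :
    KellerOssermanNeg p f ↔ KellerOssermanPos p (fun t => -f (-t)) := by
  unfold KellerOssermanNeg KellerOssermanPos
  have h := (Measure.measurePreserving_neg (volume : Measure ℝ)).integrableOn_comp_preimage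
    (Homeomorph.neg ℝ).measurableEmbedding
    (f := fun t : ℝ => (∫ s in t..(-1), f s) ^ (-(1 / p))) (s := Iio (-1))
  rw [← h]
  have hs : Neg.neg ⁻¹' Iio (-1 : ℝ) = Ioi 1 := by
    ext x
    simp
  rw [hs]
  simp only [Function.comp_def, neg_neg]
  refine integrableOn_congr_fun (fun t _ => ?_) measurableSet_Ioi
  simp only [intervalIntegral.integral_comp_neg]

theorem eq_zero_of_isNegPLaplaceSolution (hN : 0 < N) {p : ℝ} (hp : 1 < p) {f : ℝ → ℝ}
    (hf : Continuous f) (hanti : Antitone f) (hneg : ∀ t, t < 0 → 0 < f t)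
    (hpos : ∀ t, 0 < t → f t < 0) (hKn : KellerOssermanNeg p f) (hKp : KellerOssermanPos p f)
    {u : EuclideanSpace ℝ (Fin N) → ℝ} (hu : IsNegPLaplaceSolution p (fun x => f (u x)) u)
    (x : EuclideanSpace ℝ (Fin N)) : u x = 0 := by
  refine le_antisymm ?_ ?_
  · exact nonpos_of_isSolutionDivGE hN hp hf.neg hanti.neg (fun t ht => neg_pos.2 (hpos t ht))
      hKp hu.1 x
  · have h1 := hu.2.neg
    have h2 := (kellerOssermanNeg_iff p f).1 hKn
    simp only [KellerOssermanPos, neg_neg] at h1 h2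
    -- Since `Δ_p(-u) = f(u)`, the function `-u` solves the equation with nonlinearity `t ↦ f (-t)`,
    -- which is again nondecreasing.
    have := nonpos_of_isSolutionDivGE hN hp (g := fun t => f (-t)) (hf.comp continuous_neg)
      (fun s t hst => hanti (neg_le_neg hst)) (fun t ht => hneg _ (neg_neg_of_pos ht)) h2
      (u := fun x => -u x) (by simpa only [neg_neg] using h1) x
    linarith

/-! ### Power nonlinearities and part (ii) -/

theorem abs_rpow_sub_one_mul_self {q t : ℝ} (hq : 0 < q) (ht : 0 ≤ t) :
    |t| ^ (q - 1) * t = t ^ q := by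
  rcases ht.eq_or_lt with rfl | ht
  · simp [Real.zero_rpow hq.ne']
  · rw [abs_of_pos ht]
    nth_rewrite 2 [← Real.rpow_one t]
    rw [← Real.rpow_add ht]
    ring_nf

theorem continuous_abs_rpow_sub_one_mul_self {q : ℝ} (hq : 0 < q) :
    Continuous fun t : ℝ => |t| ^ (q - 1) * t := by
  have h := continuous_norm_rpow_smul_self (E := ℝ) (p := q + 1) (by linarith)
  have he : q + 1 - 2 = q - 1 := by ring
  simpa only [he, Real.norm_eq_abs, smul_eq_mul] using h

theorem monotone_abs_rpow_sub_one_mul_self {q : ℝ} (hq : 0 < q) :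
    Monotone fun t : ℝ => |t| ^ (q - 1) * t := by
  refine monotone_of_odd_of_monotoneOn_nonneg (fun t => by simp) fun s hs t ht hst => ?_
  simp only [abs_rpow_sub_one_mul_self hq (mem_Ici.1 hs),
    abs_rpow_sub_one_mul_self hq (mem_Ici.1 ht)]
  exact Real.rpow_le_rpow hs hst hq.le

/-- For large `t` the inner integral grows at least like a multiple of `t^(q+1)`, so the integrand
decays like `t^(-(q+1)/p)`; the condition `q > p - 1` says exactly that `(q+1)/p > 1`. -/
theorem kellerOssermanPos_power {p q : ℝ} (hp : 1 < p) (hq : p - 1 < q) :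
    KellerOssermanPos p (fun t => -(|t| ^ (q - 1) * t)) := by
  have hq0 : 0 < q := by linarith
  have hg := continuous_abs_rpow_sub_one_mul_self hq0
  have hmono := monotone_abs_rpow_sub_one_mul_self hq0
  have hgpos : ∀ t : ℝ, 0 < t → 0 < |t| ^ (q - 1) * t := fun t ht => by positivity
  unfold KellerOssermanPos
  simp only [neg_neg]
  set g : ℝ → ℝ := fun t => |t| ^ (q - 1) * t with hgdef
  have hK : (fun t : ℝ => (∫ s in (1 : ℝ)..t, g s) ^ (-(1 / p))) = travelKernel p 1 1 g := by
    ext t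
    simp [travelKernel]
  have hg1 : 0 < g 1 := hgpos 1 one_pos
  rw [hK, ← Ioc_union_Ioi_eq_Ioi (one_le_two (α := ℝ))]
  refine IntegrableOn.union ?_ ?_
  · have := (intervalIntegrable_iff_integrableOn_Ioc_of_le (one_le_two (α := ℝ))).1
      (intervalIntegrable_extendedKernel hp one_pos hg hmono hg1 1 2)
    refine this.congr_fun (fun s hs => ?_) measurableSet_Ioc
    simp [extendedKernel, hs.1]
  · have hexp : (q + 1) * (-(1 / p)) < -1 := by
      have : 1 < (q + 1) / p := by rw [lt_div_iff₀ (by linarith)]; linarith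
      have : (q + 1) * (-(1 / p)) = -((q + 1) / p) := by ring
      linarith
    refine Integrable.mono' ((integrableOn_Ioi_rpow_of_lt hexp two_pos).const_mul
      ((1 / 2) ^ ((q + 1) * (-(1 / p))))) (measurable_travelKernel p 1 1 hg).aestronglyMeasurable ?_
    filter_upwards [ae_restrict_mem measurableSet_Ioi] with t ht
    have ht : (2 : ℝ) < t := ht
    -- Only the half `[t/2, t]` is kept, where the integrand is at least `(t/2)^q`; `t > 2` places
    -- it to the right of `1`.
    have h1 : (t / 2) ^ (q + 1) ≤ ∫ s in (1 : ℝ)..t, g s := by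
      have h2 := mul_sub_le_integral_of_monotone hg hmono (a := t / 2) (s := t) (by linarith)
      have h3 := integral_pos_of_monotone hg hmono (a := 1) (s := t / 2) hg1 (by linarith)
      rw [← intervalIntegral.integral_add_adjacent_intervals (hg.intervalIntegrable 1 (t / 2))
        (hg.intervalIntegrable (t / 2) t)]
      have h4 : g (t / 2) * (t - t / 2) = (t / 2) ^ (q + 1) := by
        rw [hgdef]
        simp only
        rw [abs_rpow_sub_one_mul_self hq0 (by linarith), Real.rpow_add (by linarith), Real.rpow_one]
        ring
      linarith
    rw [Real.norm_of_nonneg (travelKernel_pos one_pos hg hmono hg1 (by linarith)).le,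
      ← Real.mul_rpow (by norm_num) (by linarith), Real.rpow_mul (by linarith), travelKernel, one_mul,
      one_div_mul_eq_div]
    refine Real.rpow_le_rpow_of_nonpos (by positivity) h1 ?_
    have : 0 < 1 / p := by positivity
    linarith

theorem mainTheorem6 (N : ℕ) (hN : 1 < N) (p : ℝ) (hp : 1 < p) :
    (∀ f : ℝ → ℝ, Continuous f → Antitone f →
      (∀ t, t < 0 → 0 < f t) → (∀ t, 0 < t → f t < 0) →
      KellerOssermanNeg p f → KellerOssermanPos p f →
      ∀ u : EuclideanSpace ℝ (Fin N) → ℝ,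
        IsNegPLaplaceSolution p (fun x => f (u x)) u → ∀ x, u x = 0) ∧
    (∀ q : ℝ, p - 1 < q →
      ∀ u : EuclideanSpace ℝ (Fin N) → ℝ,
        IsPLaplaceSolution p (fun x => |u x| ^ (q - 1) * u x) u → ∀ x, u x = 0) := by
  have hN0 : 0 < N := by omega
  refine ⟨fun f hf hanti hneg hpos hKn hKp u hu x =>
    eq_zero_of_isNegPLaplaceSolution hN0 hp hf hanti hneg hpos hKn hKp hu x, fun q hq u hu x => ?_⟩
  have hq0 : 0 < q := by linarith
  have hKp := kellerOssermanPos_power hp hq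
  refine eq_zero_of_isNegPLaplaceSolution hN0 hp (f := fun t => -(|t| ^ (q - 1) * t))
    (continuous_abs_rpow_sub_one_mul_self hq0).neg (monotone_abs_rpow_sub_one_mul_self hq0).neg
    (fun t ht => ?_) (fun t ht => ?_) ?_ hKp (u := u) ?_ x
  · have : 0 < |t| ^ (q - 1) := Real.rpow_pos_of_pos (abs_pos.2 ht.ne) _
    exact neg_pos.2 (mul_neg_of_pos_of_neg this ht)
  · have : 0 < |t| ^ (q - 1) := Real.rpow_pos_of_pos (abs_pos.2 ht.ne') _
    exact neg_neg_of_pos (mul_pos this ht)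
  · rw [kellerOssermanNeg_iff]
    simpa using hKp
  · simpa only [IsNegPLaplaceSolution, neg_neg] using hu
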